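/- All spaces are complex. An operator ideal $\mathcal I$ assigns to each pair of Banach spaces $X,Y$ a linear subspace $\mathcal I(X;Y)$ of $\mathcal L(X;Y)$ that contains the finite rank operators, such that $S\circ R\circ T\in\mathcal I$ whenever $R\in\mathcal I$ and $S,T$ are continuous linear operators between Banach spaces for which the composition is defined. A continuous linear operator $S\colon X\to Y$ between locally convex spaces is said to belong to $\mathcal I(X;Y)$ if $S=B\circ T\circ A$ with $G,H$ Banach spaces, $A\in\mathcal L(X;G)$, $T\in\mathcal I(G;H)$, $B\in\mathcal L(H;Y)$ (for Banach spaces $X,Y$ this gives back the original $\mathcal I(X;Y)$). A locally convex space $X$ has the $\mathcal I$-approximation property ($\mathcal I$-AP) if $\mathcal I(X;X)$ is dense in $\mathcal L(X;X)$ for the topology of uniform convergence on compact subsets of $X$. Let $E,F$ be Banach spaces and let $U\subseteq E$ be open. $\mathcal P(^nE;F)$ is the space of continuous $n$-homogeneous polynomials from $E$ to $F$ with the norm $\|P\|=\sup_{\|x\|\le1}\|P(x)\|$, and $\mathcal P_w(^nE)$ is the subspace of those $P\in\mathcal P(^nE;\mathbb C)$ that are weakly continuous on bounded sets. A bounded set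 $A\subseteq U$ is $U$-bounded if $A+V\subseteq U$ for some neighbourhood $V$ of $0$. $\mathcal H_b(U;F)$ is the space of holomorphic functions $U\to F$ that are bounded on $U$-bounded sets, and $\mathcal H_{wu}(U)$ is the space of holomorphic functions $U\to\mathbb C$ that are weakly uniformly continuous on $U$-bounded sets; both carry the topology of uniform convergence on $U$-bounded sets. Proposition. Let $\mathcal I$ be an operator ideal, let $E,F$ be Banach spaces and let $U$ be a nonempty balanced open subset of $E$. (a) $\mathcal H_b(U;F)$ has the $\mathcal I$-AP if and only if $\mathcal P(^nE;F)$ has the $\mathcal I$-AP for every integer $n\ge0$. If $E\ne\{0\}$, then $\mathcal H_b(U;F)$ has the $\mathcal I$-AP if and only if $\mathcal P(^nE;F)$ has the $\mathcal I$-AP for every integer $n\ge1$. (b) $\mathcal H_{wu}(U)$ has the $\mathcal I$-AP if and only if $\mathcal P_w(^nE)$ has the $\mathcal I$-AP for every integer $n\ge1$. -/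

import Mathlib

open Set Topology
open scoped UniformConvergence BoundedContinuousFunction Pointwise CompactConvergenceCLM

universe u v

noncomputable section

/-- An operator ideal on complex Banach spaces: for all Banach spaces `E`, `F` a linear subspace of
`E →L[ℂ] F` that contains the finite rank operators, subject to the ideal property. -/
structure OperatorIdeal where
  comp : ∀ (E F : Type u) [NormedAddCommGroup E] [NormedSpace ℂ E] [CompleteSpace E]
    [NormedAddCommGroup F] [NormedSpace ℂ F] [CompleteSpace F], Submodule ℂ (E →L[ℂ] F)
  finiteRank_mem : ∀ (E F : Type u) [NormedAddCommGroup E] [NormedSpace ℂ E] [CompleteSpace E]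
    [NormedAddCommGroup F] [NormedSpace ℂ F] [CompleteSpace F] (T : E →L[ℂ] F),
    FiniteDimensional ℂ (LinearMap.range (T : E →ₗ[ℂ] F)) → T ∈ comp E F
  comp_mem : ∀ (E F G H : Type u) [NormedAddCommGroup E] [NormedSpace ℂ E] [CompleteSpace E]
    [NormedAddCommGroup F] [NormedSpace ℂ F] [CompleteSpace F]
    [NormedAddCommGroup G] [NormedSpace ℂ G] [CompleteSpace G]
    [NormedAddCommGroup H] [NormedSpace ℂ H] [CompleteSpace H]
    (T : E →L[ℂ] F) (R : F →L[ℂ] G) (S : G →L[ℂ] H),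
    R ∈ comp F G → S ∘L R ∘L T ∈ comp E H

/-- The inferior extension of an operator ideal to topological vector spaces: operators that factor
as `Y ∘ T ∘ A` with `T` an operator of the ideal between Banach spaces. -/
def OperatorIdeal.InferiorExtension (I : OperatorIdeal.{u}) {X Z : Type u}
    [AddCommGroup X] [Module ℂ X] [TopologicalSpace X]
    [AddCommGroup Z] [Module ℂ Z] [TopologicalSpace Z] (S : X →L[ℂ] Z) : Prop :=
  ∃ (E F : Type u) (_ : NormedAddCommGroup E) (_ : NormedSpace ℂ E) (_ : CompleteSpace E)
    (_ : NormedAddCommGroup F) (_ : NormedSpace ℂ F) (_ : CompleteSpace F)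
    (A : X →L[ℂ] E) (T : E →L[ℂ] F) (Y : F →L[ℂ] Z), T ∈ I.comp E F ∧ S = Y ∘L T ∘L A

/-- Between Banach spaces the inferior extension is the ideal itself. -/
theorem OperatorIdeal.inferiorExtension_iff_mem (I : OperatorIdeal.{u}) {X Z : Type u}
    [NormedAddCommGroup X] [NormedSpace ℂ X] [CompleteSpace X]
    [NormedAddCommGroup Z] [NormedSpace ℂ Z] [CompleteSpace Z] (S : X →L[ℂ] Z) :
    I.InferiorExtension S ↔ S ∈ I.comp X Z := by
  constructor
  · rintro ⟨E, F, _, _, _, _, _, _, A, T, Y, hT, rfl⟩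
    exact I.comp_mem X E F Z A T Y hT
  · intro h
    exact ⟨X, Z, inferInstance, inferInstance, inferInstance, inferInstance, inferInstance,
      inferInstance, ContinuousLinearMap.id ℂ X, S, ContinuousLinearMap.id ℂ Z, h, rfl⟩

/-- The `I`-approximation property: the operators on `X` that belong to (the inferior extension of)
`I` are dense in the space `X →L_c[ℂ] X` of all continuous linear operators on `X` with the
compact-open topology. -/
def OperatorIdeal.HasAP (I : OperatorIdeal.{u}) (X : Type u)
    [AddCommGroup X] [Module ℂ X] [TopologicalSpace X] [IsTopologicalAddGroup X]
    [ContinuousSMul ℂ X] : Prop :=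
  closure {S : X →L_c[ℂ] X | I.InferiorExtension (X := X) (Z := X) S} = univ

section Polynomials

variable (n : ℕ) (E : Type u) (F : Type v) [NormedAddCommGroup E] [NormedSpace ℂ E]
  [NormedAddCommGroup F] [NormedSpace ℂ F]

/-- The vector space of continuous `n`-homogeneous polynomials, i.e. restrictions to the diagonal of
continuous `n`-linear maps. -/
def homogeneousPolynomials : Submodule ℂ (E → F) where
  carrier := {P | ∃ A : ContinuousMultilinearMap ℂ (fun _ : Fin n => E) F,
    ∀ x, P x = A fun _ => x}
  add_mem' := by
    rintro P Q ⟨A, hA⟩ ⟨B, hB⟩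
    exact ⟨A + B, fun x => by simp [hA, hB]⟩
  zero_mem' := ⟨0, fun x => by simp⟩
  smul_mem' := by
    rintro c P ⟨A, hA⟩
    exact ⟨c • A, fun x => by simp [hA]⟩

/-- The space `P(ⁿE;F)`, to be normed by `‖P‖ = sup_{‖x‖ ≤ 1} ‖P x‖` (a type of its own, so that it
does not carry the topology of pointwise convergence). -/
def HomPoly : Type (max u v) := homogeneousPolynomials n E F

namespace HomPoly

instance : AddCommGroup (HomPoly n E F) :=
  inferInstanceAs (AddCommGroup (homogeneousPolynomials n E F))

instance : Module ℂ (HomPoly n E F) :=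
  inferInstanceAs (Module ℂ (homogeneousPolynomials n E F))

instance : FunLike (HomPoly n E F) E F where
  coe P := P.1
  coe_injective := Subtype.val_injective

variable {n E F}

theorem add_apply (P Q : HomPoly n E F) (x : E) : (P + Q) x = P x + Q x := rfl

theorem zero_apply (x : E) : (0 : HomPoly n E F) x = 0 := rfl

theorem smul_apply (c : ℂ) (P : HomPoly n E F) (x : E) : (c • P) x = c • P x := rfl

theorem exists_multilinear (P : HomPoly n E F) :
    ∃ A : ContinuousMultilinearMap ℂ (fun _ : Fin n => E) F, ∀ x, P x = A fun _ => x := P.2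

theorem map_smul (P : HomPoly n E F) (c : ℂ) (x : E) : P (c • x) = c ^ n • P x := by
  obtain ⟨A, hA⟩ := P.exists_multilinear
  rw [hA, hA]
  simpa using A.map_smul_univ (fun _ => c) (fun _ => x)

theorem continuous (P : HomPoly n E F) : Continuous P := by
  obtain ⟨A, hA⟩ := P.exists_multilinear
  have h : (P : E → F) = fun x => A fun _ => x := funext hA
  rw [h]
  fun_prop

theorem exists_bound (P : HomPoly n E F) :
    ∃ C, ∀ x : Metric.closedBall (0 : E) 1, ‖P x‖ ≤ C := by
  obtain ⟨A, hA⟩ := P.exists_multilinear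
  refine ⟨‖A‖, fun x => ?_⟩
  rw [hA]
  refine (A.le_opNorm _).trans (mul_le_of_le_one_right (norm_nonneg _) ?_)
  exact Finset.prod_le_one (fun _ _ => norm_nonneg _) fun _ _ => mem_closedBall_zero_iff.1 x.2

/-- Restriction of a polynomial to the closed unit ball. -/
def toBall : HomPoly n E F →ₗ[ℂ] (Metric.closedBall (0 : E) 1 →ᵇ F) where
  toFun P := BoundedContinuousFunction.ofNormedAddCommGroup (fun x => P x)
    (P.continuous.comp continuous_subtype_val) P.exists_bound.choose P.exists_bound.choose_spec
  map_add' _ _ := rfl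
  map_smul' _ _ := rfl

theorem toBall_apply (P : HomPoly n E F) (x : Metric.closedBall (0 : E) 1) :
    toBall P x = P x := rfl

theorem toBall_injective : Function.Injective (toBall (n := n) (E := E) (F := F)) := by
  rw [injective_iff_map_eq_zero]
  intro P hP
  refine DFunLike.ext _ _ fun x => ?_
  have hc : (0 : ℝ) < ‖x‖ + 1 := by positivity
  have hc0 : ((‖x‖ + 1 : ℝ) : ℂ) ≠ 0 := by exact_mod_cast hc.ne'
  have hy : (((‖x‖ + 1 : ℝ) : ℂ)⁻¹ • x) ∈ Metric.closedBall (0 : E) 1 := by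
    rw [mem_closedBall_zero_iff, norm_smul, norm_inv, Complex.norm_real, Real.norm_of_nonneg hc.le,
      inv_mul_le_iff₀ hc]
    linarith
  have h := DFunLike.congr_fun hP ⟨_, hy⟩
  rw [toBall_apply, map_smul] at h
  have h' := (smul_eq_zero.1 h).resolve_left (pow_ne_zero _ (inv_ne_zero hc0))
  exact h'

instance : NormedAddCommGroup (HomPoly n E F) :=
  NormedAddCommGroup.induced _ _ (toBall (n := n) (E := E) (F := F)) toBall_injective

instance : NormedSpace ℂ (HomPoly n E F) :=
  NormedSpace.induced ℂ (HomPoly n E F) _ (toBall (n := n) (E := E) (F := F))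

theorem norm_eq_iSup (P : HomPoly n E F) :
    ‖P‖ = ⨆ x : Metric.closedBall (0 : E) 1, ‖P x‖ :=
  BoundedContinuousFunction.norm_eq_iSup_norm (toBall P)

end HomPoly

/-- The space `P_w(ⁿE)` of scalar-valued continuous `n`-homogeneous polynomials whose restriction to
every bounded set is continuous for the weak topology, as a subspace of `P(ⁿE;ℂ)`. -/
def WeakHomPoly (E : Type u) [NormedAddCommGroup E] [NormedSpace ℂ E] :
    Submodule ℂ (HomPoly n E ℂ) where
  carrier := {P | ∀ B : Set E, Bornology.IsBounded B →
    ContinuousOn (fun x : WeakSpace ℂ E => P ((toWeakSpace ℂ E).symm x))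
      (toWeakSpace ℂ E '' B)}
  add_mem' hP hQ B hB := (hP B hB).add (hQ B hB)
  zero_mem' _ _ := continuousOn_const
  smul_mem' c _ hP B hB := (hP B hB).const_smul c

end Polynomials

section Holomorphic

variable {E : Type u} [NormedAddCommGroup E] [NormedSpace ℂ E]

/-- The family of `U`-bounded sets: bounded subsets `A` of `U` with `A + V ⊆ U` for some
neighbourhood `V` of `0`. -/
def uBoundedSets (U : Set E) : Set (Set U) :=
  {A | Bornology.IsBounded (Subtype.val '' A : Set E) ∧
    ∃ V ∈ 𝓝 (0 : E), (Subtype.val '' A : Set E) + V ⊆ U}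

/-- `f : U → F` is holomorphic: near each point of `U` it is the sum of a power series. -/
def IsHolomorphic {F : Type v} [NormedAddCommGroup F] [NormedSpace ℂ F] (U : Set E) (f : U → F) :
    Prop :=
  ∃ g : E → F, AnalyticOnNhd ℂ g U ∧ ∀ x : U, g x = f x

/-- `f` is weakly uniformly continuous on `A`, i.e. uniformly continuous for the uniformity of the
weak topology of `E`. -/
def WeaklyUniformlyContinuousOn {U : Set E} (f : U → ℂ) (A : Set U) : Prop :=
  ∀ ε > 0, ∃ s : Finset (E →L[ℂ] ℂ), ∃ δ > 0, ∀ x ∈ A, ∀ y ∈ A,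
    (∀ φ ∈ s, ‖φ ((x : E) - y)‖ < δ) → ‖f x - f y‖ < ε

/-- The space `H_b(U;F)` of holomorphic functions of bounded type, with the topology of uniform
convergence on `U`-bounded sets. -/
def HolomorphicBounded (U : Set E) (F : Type v) [NormedAddCommGroup F] [NormedSpace ℂ F] :
    Submodule ℂ (U →ᵤ[uBoundedSets U] F) where
  carrier := {f | IsHolomorphic U (UniformOnFun.toFun _ f) ∧
    ∀ A ∈ uBoundedSets U, Bornology.IsBounded (UniformOnFun.toFun _ f '' A)}
  add_mem' := by
    rintro f₁ f₂ ⟨⟨g₁, hg₁, h₁⟩, hb₁⟩ ⟨⟨g₂, hg₂, h₂⟩, hb₂⟩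
    refine ⟨⟨g₁ + g₂, hg₁.add hg₂, fun x => by simp [h₁, h₂]⟩, fun A hA => ?_⟩
    refine ((hb₁ A hA).add (hb₂ A hA)).subset ?_
    rintro _ ⟨x, hx, rfl⟩
    exact Set.add_mem_add (mem_image_of_mem _ hx) (mem_image_of_mem _ hx)
  zero_mem' := by
    refine ⟨⟨0, fun _ _ => analyticAt_const, fun _ => rfl⟩, fun A _ => ?_⟩
    refine (Bornology.isBounded_singleton (x := (0 : F))).subset ?_
    rintro _ ⟨x, -, rfl⟩
    rfl
  smul_mem' := by
    rintro c f ⟨⟨g, hg, h⟩, hb⟩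
    refine ⟨⟨c • g, hg.const_smul, fun x => by simp [h]⟩, fun A hA => ?_⟩
    refine ((hb A hA).smul₀ c).subset ?_
    rintro _ ⟨x, hx, rfl⟩
    exact Set.smul_mem_smul_set (mem_image_of_mem _ hx)

instance (U : Set E) (F : Type v) [NormedAddCommGroup F] [NormedSpace ℂ F] :
    ContinuousSMul ℂ (HolomorphicBounded U F) :=
  UniformOnFun.continuousSMul_submodule_of_image_bounded ℂ U F (HolomorphicBounded U F)
    fun _ hf A hA => (NormedSpace.isVonNBounded_iff ℂ).2 (hf.2 A hA)

/-- The space `H_wu(U)` of holomorphic functions `U → ℂ` that are weakly uniformly continuous on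
`U`-bounded sets, with the topology of uniform convergence on `U`-bounded sets. -/
def HolomorphicWeakUniform (U : Set E) : Submodule ℂ (U →ᵤ[uBoundedSets U] ℂ) where
  carrier := {f | IsHolomorphic U (UniformOnFun.toFun _ f) ∧
    ∀ A ∈ uBoundedSets U, WeaklyUniformlyContinuousOn (UniformOnFun.toFun _ f) A}
  add_mem' := by
    classical
    rintro f₁ f₂ ⟨⟨g₁, hg₁, h₁⟩, hb₁⟩ ⟨⟨g₂, hg₂, h₂⟩, hb₂⟩
    refine ⟨⟨g₁ + g₂, hg₁.add hg₂, fun x => by simp [h₁, h₂]⟩, fun A hA ε hε => ?_⟩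
    obtain ⟨s₁, δ₁, hδ₁, H₁⟩ := hb₁ A hA (ε / 2) (half_pos hε)
    obtain ⟨s₂, δ₂, hδ₂, H₂⟩ := hb₂ A hA (ε / 2) (half_pos hε)
    refine ⟨s₁ ∪ s₂, min δ₁ δ₂, lt_min hδ₁ hδ₂, fun x hx y hy hxy => ?_⟩
    have e₁ := H₁ x hx y hy fun φ hφ =>
      (hxy φ (Finset.mem_union_left _ hφ)).trans_le (min_le_left _ _)
    have e₂ := H₂ x hx y hy fun φ hφ =>
      (hxy φ (Finset.mem_union_right _ hφ)).trans_le (min_le_right _ _)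
    simp only [UniformOnFun.toFun_add, Pi.add_apply, add_sub_add_comm]
    refine (norm_add_le _ _).trans_lt ?_
    linarith
  zero_mem' := ⟨⟨0, fun _ _ => analyticAt_const, fun _ => rfl⟩,
    fun A _ ε hε => ⟨∅, 1, one_pos, fun x _ y _ _ => by simpa using hε⟩⟩
  smul_mem' := by
    rintro c f ⟨⟨g, hg, h⟩, hb⟩
    refine ⟨⟨c • g, hg.const_smul, fun x => by simp [h]⟩, fun A hA ε hε => ?_⟩
    have hc : 0 < ‖c‖ + 1 := by positivity
    obtain ⟨s, δ, hδ, H⟩ := hb A hA (ε / (‖c‖ + 1)) (div_pos hε hc)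
    refine ⟨s, δ, hδ, fun x hx y hy hxy => ?_⟩
    have e := H x hx y hy hxy
    rw [lt_div_iff₀ hc] at e
    simp only [UniformOnFun.toFun_smul, Pi.smul_apply, ← smul_sub, norm_smul]
    nlinarith [norm_nonneg (UniformOnFun.toFun _ f x - UniformOnFun.toFun _ f y)]

/-- A function that is weakly uniformly continuous on a bounded set is bounded there. -/
theorem WeaklyUniformlyContinuousOn.isBounded_image {U : Set E} {f : U → ℂ} {A : Set U}
    (hf : WeaklyUniformlyContinuousOn f A) (hA : Bornology.IsBounded (Subtype.val '' A : Set E)) :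
    Bornology.IsBounded (f '' A) := by
  obtain ⟨s, δ, hδ, H⟩ := hf 1 one_pos
  let Φ : E →L[ℂ] (s → ℂ) := ContinuousLinearMap.pi fun φ => φ.1
  have hΦ : TotallyBounded ((fun x : U => Φ x) '' A) := by
    rw [← Set.image_image (fun x : E => Φ x) Subtype.val A]
    exact (Φ.lipschitz.isBounded_image hA).isCompact_closure.totallyBounded.subset subset_closure
  obtain ⟨t, htA, htfin, hcov⟩ := Metric.finite_approx_of_totallyBounded hΦ δ hδ
  obtain ⟨B, hBA, hBfin, rfl⟩ := exists_subset_image_finite_and.1 ⟨t, htA, htfin, rfl⟩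
  refine (((Bornology.isBounded_biUnion hBfin).2 fun b _ =>
    Metric.isBounded_ball (x := f b) (r := 1))).subset ?_
  rintro _ ⟨x, hx, rfl⟩
  obtain ⟨_, ⟨b, hb, rfl⟩, hxb⟩ := mem_iUnion₂.1 (hcov ⟨x, hx, rfl⟩)
  refine mem_iUnion₂.2 ⟨b, hb, ?_⟩
  rw [Metric.mem_ball, dist_eq_norm]
  refine H x hx b (hBA hb) fun φ hφ => ?_
  have h := (norm_le_pi_norm (Φ x - Φ b) ⟨φ, hφ⟩).trans_lt
    (by rwa [Metric.mem_ball, dist_eq_norm] at hxb)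
  rw [_root_.map_sub]
  exact h

instance (U : Set E) : ContinuousSMul ℂ (HolomorphicWeakUniform U) :=
  UniformOnFun.continuousSMul_submodule_of_image_bounded ℂ U ℂ (HolomorphicWeakUniform U)
    fun _ hf A hA => (NormedSpace.isVonNBounded_iff ℂ).2 ((hf.2 A hA).isBounded_image hA.1)

end Holomorphic

end

/-!
A function `f`, holomorphic on the balanced open set `U`, is the sum on `U` of its Taylor series at the
origin, and its `n`-th Taylor polynomial at `x` is the Cauchy integral `(2πi)⁻¹ ∮ z⁻⁽ⁿ⁺¹⁾ f(zx) dz`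
over the unit circle (`taylorPoly`, `hasSum_taylorPoly`). Hence in both function spaces
`f ↦ taylorPoly n f` and the restriction of polynomials to `U` are continuous operators which exhibit
the space of `n`-homogeneous polynomials as a retract, and the approximation property passes to
retracts (`OperatorIdeal.HasAP.of_retract`).

Conversely, a `U`-bounded set `A` remains `U`-bounded when multiplied by all scalars of modulus at most
some `r > 1` (`exists_one_lt_dilation_mem_uBoundedSets`), so by Cauchy's estimate the Taylor series of
`f` is dominated on `A` by a geometric series with ratio `r⁻¹`, uniformly for `f` in a compact set.
Thus the identity of the function space is, uniformly on compact sets, the limit of the sums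
`∑ n < N, ιₙ ∘ πₙ` of the projections `πₙ` to the polynomials followed by the inclusions `ιₙ`. If the
identity of every space of polynomials is a limit of operators `Sₙ` of the ideal, then `ιₙ ∘ πₙ` is a
limit of the operators `ιₙ ∘ Sₙ ∘ πₙ`, which belong to the ideal, and sums of such operators do too.
It is enough to approximate the identity (`OperatorIdeal.hasAP_iff_id_mem`), which gives the
approximation property (`OperatorIdeal.HasAP.of_tendsto_sum`, `OperatorIdeal.hasAP_iff_forall_taylor`).

For the weakly uniformly continuous functions one needs that Taylor polynomials are weakly continuous
on bounded sets, which is Cauchy's estimate for differences, and that polynomials that are weakly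
continuous on bounded sets are weakly *uniformly* continuous there
(`WeaklyContinuousOnBounded.weaklyUniformlyContinuousOnBounded`). The latter is an induction on the
degree which uses only the difference operators `f ↦ f (· + y) - f` and the weak precompactness of
bounded sets.

The degree `0` is special: the constants form a retract of the linear maps if `E ≠ 0`, and for scalar
values they are finite-dimensional.
-/

noncomputable section

namespace OperatorIdeal

/-! ### The approximation property -/

section InferiorExtension

variable {I : OperatorIdeal.{u}} {X Y Z W : Type u}
  [AddCommGroup X] [Module ℂ X] [TopologicalSpace X]
  [AddCommGroup Y] [Module ℂ Y] [TopologicalSpace Y]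
  [AddCommGroup Z] [Module ℂ Z] [TopologicalSpace Z]
  [AddCommGroup W] [Module ℂ W] [TopologicalSpace W]

theorem InferiorExtension.comp {S : Y →L[ℂ] Z} (hS : I.InferiorExtension S)
    (R : Z →L[ℂ] W) (L : X →L[ℂ] Y) : I.InferiorExtension (R ∘L S ∘L L) := by
  obtain ⟨G, H, _, _, _, _, _, _, A, T, B, hT, rfl⟩ := hS
  exact ⟨G, H, inferInstance, inferInstance, inferInstance, inferInstance, inferInstance,
    inferInstance, A ∘L L, T, R ∘L B, hT, rfl⟩

theorem inferiorExtension_zero : I.InferiorExtension (0 : X →L[ℂ] Y) :=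
  ⟨PUnit, PUnit, inferInstance, inferInstance, inferInstance, inferInstance, inferInstance,
    inferInstance, 0, 0, 0, Submodule.zero_mem _, by simp⟩

/-- A sum of two operators of the ideal factors through the products of the Banach spaces through
which the summands factor. -/
theorem InferiorExtension.add [IsTopologicalAddGroup Y] {S₁ S₂ : X →L[ℂ] Y}
    (h₁ : I.InferiorExtension S₁) (h₂ : I.InferiorExtension S₂) :
    I.InferiorExtension (S₁ + S₂) := by
  obtain ⟨G₁, H₁, _, _, _, _, _, _, A₁, T₁, B₁, hT₁, rfl⟩ := h₁
  obtain ⟨G₂, H₂, _, _, _, _, _, _, A₂, T₂, B₂, hT₂, rfl⟩ := h₂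
  refine ⟨G₁ × G₂, H₁ × H₂, inferInstance, inferInstance, inferInstance, inferInstance,
    inferInstance, inferInstance, A₁.prod A₂,
    .inl ℂ H₁ H₂ ∘L T₁ ∘L .fst ℂ G₁ G₂ + .inr ℂ H₁ H₂ ∘L T₂ ∘L .snd ℂ G₁ G₂,
    B₁.coprod B₂, Submodule.add_mem _ (I.comp_mem _ _ _ _ _ _ _ hT₁) (I.comp_mem _ _ _ _ _ _ _ hT₂),
    ?_⟩
  ext x
  simp

end InferiorExtension

variable {I : OperatorIdeal.{u}}
  {X : Type u} [AddCommGroup X] [Module ℂ X] [TopologicalSpace X] [IsTopologicalAddGroup X]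
  [ContinuousSMul ℂ X]
  {Y : Type u} [AddCommGroup Y] [Module ℂ Y] [TopologicalSpace Y] [IsTopologicalAddGroup Y]
  [ContinuousSMul ℂ Y]

/-- A continuous linear operator, as an element of the space of operators with the topology of
compact convergence. -/
abbrev toCompactConvergence : (X →L[ℂ] Y) ≃ₗ[ℂ] (X →L_c[ℂ] Y) :=
  ContinuousLinearMap.toUniformConvergenceCLM (RingHom.id ℂ) Y {K : Set X | IsCompact K}

variable (I X) in
/-- The operators on `X` that belong to the inferior extension of `I`, as an additive submonoid of
the space of all operators with the topology of compact convergence. -/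
def operators : AddSubmonoid (X →L_c[ℂ] X) where
  carrier := {S | I.InferiorExtension (X := X) (Z := X) S}
  zero_mem' := inferiorExtension_zero
  add_mem' h₁ h₂ := InferiorExtension.add h₁ h₂

/-- It is enough to approximate the identity, since `T = T ∘ id` and `S ↦ T ∘ S` is continuous. -/
theorem hasAP_iff_id_mem : I.HasAP X ↔
    toCompactConvergence (.id ℂ X) ∈ (I.operators X).topologicalClosure := by
  refine ⟨fun h => h.ge (mem_univ _), fun h => eq_univ_of_forall fun T => ?_⟩
  exact map_mem_closure ((ContinuousLinearMap.postcompCompactConvergenceCLM X T).continuous) h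
    fun S hS => InferiorExtension.comp (X := X) hS T (.id ℂ X)

/-- An operator factoring through a space with the approximation property is a limit of operators
of the ideal. -/
theorem HasAP.comp_mem_closure (hY : I.HasAP Y) (ι : Y →L[ℂ] X) (π : X →L[ℂ] Y) :
    toCompactConvergence (ι ∘L π) ∈ (I.operators X).topologicalClosure :=
  map_mem_closure
    (f := fun S => ContinuousLinearMap.postcompCompactConvergenceCLM X ι
      (ContinuousLinearMap.precompCompactConvergenceCLM Y π S))
    (((ContinuousLinearMap.postcompCompactConvergenceCLM X ι).continuous).comp
      (ContinuousLinearMap.precompCompactConvergenceCLM Y π).continuous)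
    (hasAP_iff_id_mem.1 hY) fun _ hS =>
      InferiorExtension.comp (X := X) (Y := Y) (Z := Y) (W := X) hS ι π

theorem HasAP.of_retract (hX : I.HasAP X) (ι : Y →L[ℂ] X) (π : X →L[ℂ] Y)
    (h : ∀ y, π (ι y) = y) : I.HasAP Y := by
  rw [hasAP_iff_id_mem]
  have hid : π ∘L ι = .id ℂ Y := ContinuousLinearMap.ext h
  exact hid ▸ hX.comp_mem_closure π ι

/-- If the identity is the limit, uniformly on compact sets, of the partial sums of a series of
operators, each factoring through a space with the approximation property, then the space has the
approximation property. -/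
theorem HasAP.of_tendsto_sum {Y : ℕ → Type u} [∀ n, AddCommGroup (Y n)] [∀ n, Module ℂ (Y n)]
    [∀ n, TopologicalSpace (Y n)] [∀ n, IsTopologicalAddGroup (Y n)] [∀ n, ContinuousSMul ℂ (Y n)]
    (hY : ∀ n, I.HasAP (Y n)) (ι : ∀ n, Y n →L[ℂ] X) (π : ∀ n, X →L[ℂ] Y n)
    (h : ∀ K : Set X, IsCompact K → ∀ W ∈ 𝓝 (0 : X), ∀ᶠ N in Filter.atTop, ∀ x ∈ K,
      (∑ n ∈ Finset.range N, ι n (π n x)) - x ∈ W) : I.HasAP X := by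
  rw [hasAP_iff_id_mem]
  refine (I.operators X).isClosed_topologicalClosure.mem_of_tendsto (b := Filter.atTop)
    (f := fun N => ∑ n ∈ Finset.range N, toCompactConvergence (ι n ∘L π n)) ?_ <|
    .of_forall fun _ => sum_mem fun n _ => (hY n).comp_mem_closure (ι n) (π n)
  rw [← tendsto_sub_nhds_zero_iff, CompactConvergenceCLM.hasBasis_nhds_zero.tendsto_right_iff]
  rintro ⟨K, W⟩ ⟨hK, hW⟩
  filter_upwards [h K hK W hW] with N hN x hx
  convert hN x hx using 1
  rw [← map_sum]
  have e : (∑ n ∈ Finset.range N, ι n ∘L π n) x = ∑ n ∈ Finset.range N, ι n (π n x) := by simp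
  exact congrArg (· - x) e

theorem hasAP_of_finiteDimensional (I : OperatorIdeal.{u}) (X : Type u) [NormedAddCommGroup X]
    [NormedSpace ℂ X] [FiniteDimensional ℂ X] : I.HasAP X := by
  have := FiniteDimensional.complete ℂ X
  exact hasAP_iff_id_mem.2 <| subset_closure <|
    (I.inferiorExtension_iff_mem (.id ℂ X)).2 (I.finiteRank_mem X X _ inferInstance)

end OperatorIdeal

/-! ### `U`-bounded sets of a balanced open set -/

section UBounded

variable {E : Type u} [NormedAddCommGroup E] {U : Set E}

theorem mem_uBoundedSets_iff {A : Set U} :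
    A ∈ uBoundedSets U ↔ (∃ M, ∀ x ∈ A, ‖(x : E)‖ ≤ M) ∧
      ∃ δ > 0, ∀ x ∈ A, ∀ v : E, ‖v‖ < δ → (x : E) + v ∈ U := by
  refine and_congr ?_ ⟨?_, ?_⟩
  · simp [isBounded_iff_forall_norm_le]
  · rintro ⟨V, hV, h⟩
    obtain ⟨δ, hδ, hδV⟩ := Metric.mem_nhds_iff.1 hV
    exact ⟨δ, hδ, fun x hx v hv =>
      h (add_mem_add (mem_image_of_mem _ hx) (hδV (mem_ball_zero_iff.2 hv)))⟩
  · rintro ⟨δ, hδ, h⟩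
    refine ⟨Metric.ball 0 δ, Metric.ball_mem_nhds _ hδ, ?_⟩
    rintro _ ⟨_, ⟨x, hx, rfl⟩, v, hv, rfl⟩
    exact h x hx v (mem_ball_zero_iff.1 hv)

theorem singleton_mem_uBoundedSets (hU : IsOpen U) (x : U) : {x} ∈ uBoundedSets U := by
  obtain ⟨δ, hδ, h⟩ := Metric.isOpen_iff.1 hU x x.2
  exact mem_uBoundedSets_iff.2 ⟨⟨‖(x : E)‖, by simp⟩, δ, hδ, by
    rintro _ rfl v hv
    exact h (by simpa using hv)⟩

/-- Some closed ball around the origin is `U`-bounded. -/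
theorem exists_closedBall_mem_uBoundedSets (hU : IsOpen U) (h0 : (0 : E) ∈ U) :
    ∃ ρ > 0, Metric.closedBall (0 : E) ρ ⊆ U ∧
      {x : U | ‖(x : E)‖ ≤ ρ} ∈ uBoundedSets U := by
  obtain ⟨δ, hδ, h⟩ := Metric.isOpen_iff.1 hU 0 h0
  refine ⟨δ / 2, half_pos hδ, (Metric.closedBall_subset_ball (half_lt_self hδ)).trans h,
    mem_uBoundedSets_iff.2 ⟨⟨δ / 2, fun x hx => hx⟩, δ / 2, half_pos hδ, fun x hx v hv => h ?_⟩⟩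
  have hx' : ‖(x : E)‖ ≤ δ / 2 := hx
  rw [mem_ball_zero_iff]
  linarith [norm_add_le (x : E) v]

variable [NormedSpace ℂ E]

/-- A `U`-bounded set stays `U`-bounded when it is multiplied by all scalars of modulus at most
some `r > 1`. -/
theorem exists_one_lt_dilation_mem_uBoundedSets (hU : IsOpen U) (hbal : Balanced ℂ U)
    (h0 : (0 : E) ∈ U) {A : Set U} (hA : A ∈ uBoundedSets U) :
    ∃ r : ℝ, 1 < r ∧ (∀ x ∈ A, ∀ z : ℂ, ‖z‖ ≤ r → z • (x : E) ∈ U) ∧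
      {y : U | ∃ x ∈ A, ∃ z : ℂ, ‖z‖ ≤ r ∧ (y : E) = z • (x : E)} ∈ uBoundedSets U := by
  obtain ⟨⟨M, hM⟩, δ, hδ, hAδ⟩ := mem_uBoundedSets_iff.1 hA
  obtain ⟨ρ, hρ, hball⟩ := Metric.isOpen_iff.1 hU 0 h0
  obtain ⟨M', hM'0, hM'⟩ : ∃ M' > 0, ∀ x ∈ A, ‖(x : E)‖ ≤ M' :=
    ⟨max M 1, by positivity, fun x hx => (hM x hx).trans (le_max_left _ _)⟩
  set r : ℝ := 1 + δ / (2 * M') with hr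
  have hr1 : 1 < r := by rw [hr]; linarith [show 0 < δ / (2 * M') by positivity]
  have hrM : (r - 1) * M' = δ / 2 := by rw [hr]; field_simp; ring
  -- Scalars of modulus below `c` move `A` into the ball of radius `ρ / 2`.
  set c : ℝ := ρ / (2 * M') with hc
  have hc0 : 0 < c := by positivity
  have hcM : c * M' = ρ / 2 := by rw [hc]; field_simp
  set η : ℝ := min (ρ / 2) (c * δ / (2 * r)) with hη
  have hη0 : 0 < η := by positivity
  have key : ∀ x ∈ A, ∀ z : ℂ, ‖z‖ ≤ r → ∀ v : E, ‖v‖ < η → z • (x : E) + v ∈ U := by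
    intro x hx z hz v hv
    rcases lt_or_ge ‖z‖ c with hzc | hzc
    · refine hball (mem_ball_zero_iff.2 ((norm_add_le _ _).trans_lt ?_))
      have h1 : ‖z • (x : E)‖ ≤ ρ / 2 := by
        rw [norm_smul, ← hcM]
        exact mul_le_mul hzc.le (hM' x hx) (norm_nonneg _) hc0.le
      linarith [hv.trans_le (min_le_left _ _)]
    · have hz0 : z ≠ 0 := norm_pos_iff.1 (hc0.trans_le hzc)
      have hr0 : (r : ℂ) ≠ 0 := by exact_mod_cast (by linarith : r ≠ 0)
      -- The point is `z / r` times a point at distance less than `δ` from `x`.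
      have e : z • (x : E) + v =
          (z / r) • ((x : E) + (((r - 1 : ℝ) : ℂ) • (x : E) + ((r : ℂ) / z) • v)) := by
        have h1 : (z / r) * ((r : ℂ) / z) = 1 := by field_simp
        have h2 : z / r + (z / r) * ((r - 1 : ℝ) : ℂ) = z := by
          push_cast
          field_simp
          ring
        rw [smul_add, smul_add, smul_smul, smul_smul, h1, one_smul, ← add_assoc, ← add_smul, h2]
      rw [e]
      refine hbal.smul_mem ?_ (hAδ x hx _ ((norm_add_le _ _).trans_lt ?_))
      · rw [norm_div, Complex.norm_real, Real.norm_of_nonneg (by linarith)]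
        exact (div_le_one (by linarith)).2 hz
      · have h1 : ‖((r - 1 : ℝ) : ℂ) • (x : E)‖ ≤ δ / 2 := by
          rw [norm_smul, Complex.norm_real, Real.norm_of_nonneg (by linarith), ← hrM]
          exact mul_le_mul_of_nonneg_left (hM' x hx) (by linarith)
        have h2 : ‖((r : ℂ) / z) • v‖ < δ / 2 := by
          rw [norm_smul, norm_div, Complex.norm_real, Real.norm_of_nonneg (by linarith)]
          calc r / ‖z‖ * ‖v‖ ≤ r / c * ‖v‖ := by gcongr
            _ < r / c * (c * δ / (2 * r)) := by
              gcongr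
              exact hv.trans_le (min_le_right _ _)
            _ = δ / 2 := by
              field_simp
        linarith
  refine ⟨r, hr1, fun x hx z hz => by simpa using key x hx z hz 0 (by simpa using hη0),
    mem_uBoundedSets_iff.2 ⟨⟨r * M', ?_⟩, η, hη0, ?_⟩⟩
  · rintro y ⟨x, hx, z, hz, hy⟩
    rw [hy, norm_smul]
    exact mul_le_mul hz (hM' x hx) (norm_nonneg _) (by linarith)
  · rintro y ⟨x, hx, z, hz, hy⟩ v hv
    rw [hy]
    exact key x hx z hz v hv

end UBounded

/-! ### Taylor polynomials at the origin -/

section Taylor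

variable {E : Type u} {F : Type v} [NormedAddCommGroup F] {U : Set E}

/-- The extension by zero of a function on `U` to the whole space. -/
def zeroExtend (f : U → F) : E → F := Function.extend Subtype.val f 0

theorem zeroExtend_apply (f : U → F) (x : U) : zeroExtend f x = f x :=
  Subtype.val_injective.extend_apply f 0 x

variable [NormedAddCommGroup E] [NormedSpace ℂ E] [NormedSpace ℂ F]

theorem IsHolomorphic.analyticOnNhd_zeroExtend {f : U → F} (hU : IsOpen U)
    (hf : IsHolomorphic U f) : AnalyticOnNhd ℂ (zeroExtend f) U := by
  obtain ⟨g, hg, hgf⟩ := hf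
  refine hg.congr hU fun x hx => ?_
  rw [hgf ⟨x, hx⟩]
  exact (zeroExtend_apply f ⟨x, hx⟩).symm

/-- The value at `x` of the `n`-th Taylor polynomial of `f` at the origin, expressed by Cauchy's
formula as the integral `(2πi)⁻¹ ∮ z⁻⁽ⁿ⁺¹⁾ f(zx) dz` over the unit circle. -/
def cauchyCoeff (n : ℕ) (f : U → F) (x : E) : F :=
  (2 * Real.pi * Complex.I : ℂ)⁻¹ •
    ∮ z in C(0, 1), z⁻¹ ^ n • z⁻¹ • zeroExtend f (z • x)

theorem IsHolomorphic.circleIntegrable {f : U → F} (hU : IsOpen U) (hbal : Balanced ℂ U)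
    (hf : IsHolomorphic U f) (n : ℕ) {x : E} (hx : x ∈ U) :
    CircleIntegrable (fun z : ℂ => z⁻¹ ^ n • z⁻¹ • zeroExtend f (z • x)) 0 1 := by
  refine ContinuousOn.circleIntegrable zero_le_one ?_
  have h0 : ∀ z ∈ Metric.sphere (0 : ℂ) 1, z ≠ 0 := fun z hz =>
    norm_pos_iff.1 (by rw [mem_sphere_zero_iff_norm.1 hz]; exact one_pos)
  have hinv : ContinuousOn (fun z : ℂ => z⁻¹) (Metric.sphere 0 1) := continuousOn_inv₀.mono h0
  have hc : ContinuousOn (fun z : ℂ => zeroExtend f (z • x)) (Metric.sphere 0 1) :=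
    (hf.analyticOnNhd_zeroExtend hU).continuousOn.comp (by fun_prop) fun z hz =>
      hbal.smul_mem (mem_sphere_zero_iff_norm.1 hz).le hx
  exact (hinv.pow n).smul (hinv.smul hc)

theorem cauchyCoeff_add {f g : U → F} (hU : IsOpen U) (hbal : Balanced ℂ U)
    (hf : IsHolomorphic U f) (hg : IsHolomorphic U g) (n : ℕ) {x : E} (hx : x ∈ U) :
    cauchyCoeff n (f + g) x = cauchyCoeff n f x + cauchyCoeff n g x := by
  rw [cauchyCoeff, cauchyCoeff, cauchyCoeff, ← smul_add, ← circleIntegral.integral_add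
    (hf.circleIntegrable hU hbal n hx) (hg.circleIntegrable hU hbal n hx)]
  congr 1
  refine circleIntegral.integral_congr zero_le_one fun z hz => ?_
  have hzx : z • x ∈ U := hbal.smul_mem (mem_sphere_zero_iff_norm.1 hz).le hx
  have h (k : U → F) : zeroExtend k (z • x) = k ⟨z • x, hzx⟩ := zeroExtend_apply k ⟨_, hzx⟩
  simp only [h, Pi.add_apply, smul_add]

theorem cauchyCoeff_smul (c : ℂ) (f : U → F) (hbal : Balanced ℂ U) (n : ℕ) {x : E} (hx : x ∈ U) :
    cauchyCoeff n (c • f) x = c • cauchyCoeff n f x := by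
  rw [cauchyCoeff, cauchyCoeff, smul_comm c,
    ← circleIntegral.integral_smul c fun z : ℂ => z⁻¹ ^ n • z⁻¹ • zeroExtend f (z • x)]
  congr 1
  refine circleIntegral.integral_congr zero_le_one fun z hz => ?_
  have hzx : z • x ∈ U := hbal.smul_mem (mem_sphere_zero_iff_norm.1 hz).le hx
  have h (k : U → F) : zeroExtend k (z • x) = k ⟨z • x, hzx⟩ := zeroExtend_apply k ⟨_, hzx⟩
  simp only [h, Pi.smul_apply, smul_comm c]

/-- Cauchy's estimate. -/
theorem norm_cauchyCoeff_le {f : U → F} (n : ℕ) {x : E} {C : ℝ}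
    (hC : ∀ z : ℂ, ‖z‖ = 1 → ‖zeroExtend f (z • x)‖ ≤ C) : ‖cauchyCoeff n f x‖ ≤ C := by
  rw [← one_mul C]
  refine circleIntegral.norm_two_pi_i_inv_smul_integral_le_of_norm_le_const zero_le_one
    fun z hz => ?_
  have hz1 := mem_sphere_zero_iff_norm.1 hz
  simpa [norm_smul, hz1] using hC z hz1

/-- Cauchy's estimate for the difference of two values of a Taylor polynomial. -/
theorem norm_cauchyCoeff_sub_le {f : U → F} (hU : IsOpen U) (hbal : Balanced ℂ U)
    (hf : IsHolomorphic U f) (n : ℕ) {x y : E} (hx : x ∈ U) (hy : y ∈ U) {C : ℝ}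
    (hC : ∀ z : ℂ, ‖z‖ = 1 → ‖zeroExtend f (z • x) - zeroExtend f (z • y)‖ ≤ C) :
    ‖cauchyCoeff n f x - cauchyCoeff n f y‖ ≤ C := by
  rw [cauchyCoeff, cauchyCoeff, ← smul_sub, ← circleIntegral.integral_sub
    (hf.circleIntegrable hU hbal n hx) (hf.circleIntegrable hU hbal n hy), ← one_mul C]
  refine circleIntegral.norm_two_pi_i_inv_smul_integral_le_of_norm_le_const zero_le_one
    fun z hz => ?_
  have hz1 := mem_sphere_zero_iff_norm.1 hz
  simpa [← smul_sub, norm_smul, hz1] using hC z hz1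

/-- On each disc `{zx : |z| < 1}` the function is the sum of its Cauchy coefficients. -/
theorem IsHolomorphic.hasFPowerSeriesOnBall [CompleteSpace F] {f : U → F} (hU : IsOpen U)
    (hbal : Balanced ℂ U) (hf : IsHolomorphic U f) {x : E} (hx : x ∈ U) :
    HasFPowerSeriesOnBall (fun z : ℂ => zeroExtend f (z • x))
      (cauchyPowerSeries (fun z : ℂ => zeroExtend f (z • x)) 0 1) 0 1 := by
  have h : DifferentiableOn ℂ (fun z : ℂ => zeroExtend f (z • x)) (Metric.closedBall 0 1) := by
    intro z hz
    have hzx : z • x ∈ U := hbal.smul_mem (mem_closedBall_zero_iff.1 hz) hx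
    exact ((hf.analyticOnNhd_zeroExtend hU _ hzx).differentiableAt.comp z
      (by fun_prop : DifferentiableAt ℂ (fun z : ℂ => z • x) z)).differentiableWithinAt
  simpa using DifferentiableOn.hasFPowerSeriesOnBall (R := 1) (by simpa using h) one_pos

theorem cauchyPowerSeries_zeroExtend_apply (f : U → F) (n : ℕ) (x : E) (w : ℂ) :
    (cauchyPowerSeries (fun z : ℂ => zeroExtend f (z • x)) 0 1 n fun _ => w) =
      w ^ n • cauchyCoeff n f x := by
  rw [cauchyPowerSeries_apply, cauchyCoeff, smul_comm (w ^ n),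
    ← circleIntegral.integral_smul (w ^ n) fun z : ℂ => z⁻¹ ^ n • z⁻¹ • zeroExtend f (z • x)]
  simp only [sub_zero, div_eq_mul_inv, mul_pow, mul_smul]

theorem IsHolomorphic.exists_homPoly_eq_cauchyCoeff [CompleteSpace F] {f : U → F} (hU : IsOpen U)
    (hbal : Balanced ℂ U) (h0 : (0 : E) ∈ U) (hf : IsHolomorphic U f) (n : ℕ) :
    ∃ P : HomPoly n E F, ∀ x ∈ U, P x = cauchyCoeff n f x := by
  obtain ⟨p, hp⟩ := hf.analyticOnNhd_zeroExtend hU 0 h0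
  refine ⟨⟨fun x => p n fun _ => x, p n, fun _ => rfl⟩, fun x hx => ?_⟩
  have hp' : HasFPowerSeriesAt (zeroExtend f) p (ContinuousLinearMap.toSpanSingleton ℂ x 0) := by
    rwa [map_zero]
  have h := hp'.compContinuousLinearMap.eq_formalMultilinearSeries
      (hf.hasFPowerSeriesOnBall hU hbal hx).hasFPowerSeriesAt
  have e := cauchyPowerSeries_zeroExtend_apply f n x 1
  rw [← h, one_pow, one_smul, FormalMultilinearSeries.compContinuousLinearMap_apply] at e
  rw [← e]
  exact congrArg (p n) (funext fun _ => (one_smul ℂ x).symm)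

/-- Homogeneous polynomials that agree on a neighbourhood of the origin are equal. -/
theorem HomPoly.eq_of_eqOn {n : ℕ} {P Q : HomPoly n E F} (hU : U ∈ 𝓝 (0 : E))
    (h : ∀ x ∈ U, P x = Q x) : P = Q := by
  refine DFunLike.ext _ _ fun x => ?_
  obtain ⟨c, hc, hc0⟩ : ∃ c : ℂ, c • x ∈ U ∧ c ≠ 0 := by
    have ht : Filter.Tendsto (fun c : ℂ => c • x) (𝓝[≠] 0) (𝓝 0) := by
      have : Continuous fun c : ℂ => c • x := by fun_prop
      simpa using (this.tendsto 0).mono_left nhdsWithin_le_nhds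
    exact ((ht.eventually hU).and self_mem_nhdsWithin).exists
  have e := h _ hc
  rw [HomPoly.map_smul, HomPoly.map_smul] at e
  exact smul_right_injective F (pow_ne_zero n hc0) e

variable [CompleteSpace F]

/-- The `n`-th Taylor polynomial at the origin of a holomorphic function on a balanced open set. -/
def taylorPoly (hU : IsOpen U) (hbal : Balanced ℂ U) (h0 : (0 : E) ∈ U) (n : ℕ) (f : U → F)
    (hf : IsHolomorphic U f) : HomPoly n E F :=
  (hf.exists_homPoly_eq_cauchyCoeff hU hbal h0 n).choose

section

variable (hU : IsOpen U) (hbal : Balanced ℂ U) (h0 : (0 : E) ∈ U) (n : ℕ) {f : U → F}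
  (hf : IsHolomorphic U f)

theorem taylorPoly_apply {x : E} (hx : x ∈ U) :
    taylorPoly hU hbal h0 n f hf x = cauchyCoeff n f x :=
  (hf.exists_homPoly_eq_cauchyCoeff hU hbal h0 n).choose_spec x hx

/-- The Taylor series at the origin converges to the function on the whole of `U`: the point `x` is
inside the disc `{z(rx) : |z| < 1}` for some `r > 1` with `rx ∈ U`. -/
theorem hasSum_taylorPoly (x : U) :
    HasSum (fun n => taylorPoly hU hbal h0 n f hf x) (f x) := by
  obtain ⟨r, hr, hrU, -⟩ := exists_one_lt_dilation_mem_uBoundedSets hU hbal h0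
    (singleton_mem_uBoundedSets hU x)
  have hr0 : (r : ℂ) ≠ 0 := by exact_mod_cast (by linarith : r ≠ 0)
  have hrn : ‖(r : ℂ)‖ = r := by rw [Complex.norm_real, Real.norm_of_nonneg (by linarith)]
  have hrx : (r : ℂ) • (x : E) ∈ U := hrU x rfl r hrn.le
  have h := (hf.hasFPowerSeriesOnBall hU hbal hrx).hasSum (y := (r : ℂ)⁻¹) (by
    rw [← ENNReal.ofReal_one, Metric.eball_ofReal, mem_ball_zero_iff, norm_inv, hrn]
    exact inv_lt_one_of_one_lt₀ hr)
  simp only [cauchyPowerSeries_zeroExtend_apply, zero_add, inv_smul_smul₀ hr0] at h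
  rw [zeroExtend_apply] at h
  convert h using 2 with n
  rw [← taylorPoly_apply hU hbal h0 n hf hrx, HomPoly.map_smul, smul_smul, ← mul_pow,
    inv_mul_cancel₀ hr0, one_pow, one_smul]

theorem HomPoly.eq_taylorPoly {P : HomPoly n E F} (hP : ∀ x : U, f x = P x) :
    taylorPoly hU hbal h0 n f hf = P := by
  refine HomPoly.eq_of_eqOn (hU.mem_nhds h0) fun x hx => ?_
  rw [taylorPoly_apply hU hbal h0 n hf hx, cauchyCoeff]
  have h : (∮ z in C(0, 1), z⁻¹ ^ n • z⁻¹ • zeroExtend f (z • x)) =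
      ∮ z in C(0, 1), (z - 0)⁻¹ • P x := by
    refine circleIntegral.integral_congr zero_le_one fun z hz => ?_
    have hz1 := mem_sphere_zero_iff_norm.1 hz
    have hz0 : z ≠ 0 := norm_pos_iff.1 (by rw [hz1]; exact one_pos)
    have hzx : z • x ∈ U := hbal.smul_mem hz1.le hx
    have e : zeroExtend f (z • x) = P (z • x) := (zeroExtend_apply f ⟨_, hzx⟩).trans (hP ⟨_, hzx⟩)
    simp only [e, HomPoly.map_smul, sub_zero]
    rw [smul_comm z⁻¹, smul_smul, ← mul_pow, inv_mul_cancel₀ hz0, one_pow, one_smul]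
  rw [h, circleIntegral.integral_smul_const, circleIntegral.integral_sub_center_inv _ one_ne_zero,
    inv_smul_smul₀ Complex.two_pi_I_ne_zero]

end

end Taylor

/-! ### Weak continuity of polynomials on bounded sets -/

section WeakContinuity

/-- `f` is a polynomial of degree at most `n` in the sense of Fréchet: the difference operators
`f ↦ f (· + y) - f` lower the degree, and the functions of degree `0` are the constants. -/
def HasDegreeLE {E : Type u} [AddCommGroup E] : ℕ → (E → ℂ) → Prop
  | 0, f => ∀ x y, f x = f y
  | n + 1, f => ∀ y, HasDegreeLE n fun x => f (x + y) - f x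

section

variable {E : Type u} [AddCommGroup E]

theorem HasDegreeLE.add {n : ℕ} {f g : E → ℂ} (hf : HasDegreeLE n f) (hg : HasDegreeLE n g) :
    HasDegreeLE n fun x => f x + g x := by
  induction n generalizing f g with
  | zero => exact fun x y => congrArg₂ (· + ·) (hf x y) (hg x y)
  | succ n ih =>
    intro y
    convert ih (hf y) (hg y) using 2
    ring

theorem hasDegreeLE_zero (n : ℕ) : HasDegreeLE n fun _ : E => 0 := by
  induction n with
  | zero => exact fun _ _ => rfl
  | succ n ih => exact fun y => by simpa using ih

theorem HasDegreeLE.sum {ι : Type*} {n : ℕ} {s : Finset ι} {f : ι → E → ℂ}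
    (h : ∀ i ∈ s, HasDegreeLE n (f i)) : HasDegreeLE n fun x => ∑ i ∈ s, f i x := by
  classical
  induction s using Finset.induction_on with
  | empty => simpa using hasDegreeLE_zero n
  | insert a s ha ih =>
    simp only [Finset.sum_insert ha]
    exact (h a (Finset.mem_insert_self a s)).add
      (ih fun i hi => h i (Finset.mem_insert_of_mem hi))

/-- A multilinear map in which `x` is inserted into at most `n` slots is of degree at most `n`
in `x`. -/
theorem MultilinearMap.hasDegreeLE_piecewise [Module ℂ E] {ι : Type*} [DecidableEq ι]
    (A : MultilinearMap ℂ (fun _ : ι => E) ℂ) (c : ι → E) {n : ℕ} {s : Finset ι}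
    (hs : s.card ≤ n) : HasDegreeLE n fun x => A (s.piecewise (fun _ => x) c) := by
  induction n generalizing s c with
  | zero =>
    obtain rfl := Finset.card_eq_zero.1 (Nat.le_zero.1 hs)
    intro x y
    simp
  | succ n ih =>
    intro y
    have key (x : E) : A (s.piecewise (fun _ => x + y) c) - A (s.piecewise (fun _ => x) c) =
        ∑ t ∈ s.powerset.erase s, A (t.piecewise (fun _ => x) (s.piecewise (fun _ => y) c)) := by
      have h := A.map_piecewise_add (fun _ => x) (s.piecewise (fun _ => y) c) s
      rw [← Finset.add_sum_erase _ _ (Finset.mem_powerset_self s)] at h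
      have e₁ : s.piecewise ((fun _ => x) + s.piecewise (fun _ => y) c)
          (s.piecewise (fun _ => y) c) = s.piecewise (fun _ => x + y) c := by
        ext i
        by_cases hi : i ∈ s <;> simp [hi]
      have e₂ : s.piecewise (fun _ => x) (s.piecewise (fun _ => y) c) =
          s.piecewise (fun _ => x) c := by
        ext i
        by_cases hi : i ∈ s <;> simp [hi]
      rw [e₁, e₂] at h
      rw [h, add_sub_cancel_left]
    simp only [key]
    refine HasDegreeLE.sum fun t ht => ih _ ?_
    obtain ⟨hne, hts⟩ := Finset.mem_erase.1 ht
    have := Finset.card_lt_card ((Finset.mem_powerset.1 hts).ssubset_of_ne hne)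
    omega

end

variable {E : Type u} [NormedAddCommGroup E] [NormedSpace ℂ E]

theorem HomPoly.hasDegreeLE {n : ℕ} (P : HomPoly n E ℂ) : HasDegreeLE n P := by
  obtain ⟨A, hA⟩ := P.exists_multilinear
  have h := A.toMultilinearMap.hasDegreeLE_piecewise (n := n) 0 (s := Finset.univ) (by simp)
  convert h using 2 with x
  simpa using hA x

/-- `f` is continuous for the weak topology on all bounded sets. Bounded sets enter through balls
around the origin and weak neighbourhoods through finite sets of functionals. -/
def WeaklyContinuousOnBounded (f : E → ℂ) : Prop :=
  ∀ R : ℝ, ∀ x : E, ‖x‖ ≤ R → ∀ ε > 0, ∃ s : Finset (E →L[ℂ] ℂ), ∃ δ > 0, ∀ y : E, ‖y‖ ≤ R →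
    (∀ φ ∈ s, ‖φ (y - x)‖ < δ) → ‖f y - f x‖ < ε

/-- `f` is uniformly continuous for the weak uniformity on all bounded sets. -/
def WeaklyUniformlyContinuousOnBounded (f : E → ℂ) : Prop :=
  ∀ R : ℝ, ∀ ε > 0, ∃ s : Finset (E →L[ℂ] ℂ), ∃ δ > 0, ∀ x y : E, ‖x‖ ≤ R → ‖y‖ ≤ R →
    (∀ φ ∈ s, ‖φ (x - y)‖ < δ) → ‖f x - f y‖ < ε

theorem WeaklyUniformlyContinuousOnBounded.weaklyContinuousOnBounded {f : E → ℂ}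
    (hf : WeaklyUniformlyContinuousOnBounded f) : WeaklyContinuousOnBounded f := by
  intro R x hx ε hε
  obtain ⟨s, δ, hδ, h⟩ := hf R ε hε
  exact ⟨s, δ, hδ, fun y hy => h y x hy hx⟩

theorem WeaklyContinuousOnBounded.difference {f : E → ℂ} (hf : WeaklyContinuousOnBounded f)
    (y : E) : WeaklyContinuousOnBounded fun x => f (x + y) - f x := by
  classical
  intro R x hx ε hε
  have hxy {z : E} (hz : ‖z‖ ≤ R) : ‖z + y‖ ≤ R + ‖y‖ :=
    (norm_add_le _ _).trans (by linarith)
  obtain ⟨s₁, δ₁, hδ₁, h₁⟩ := hf (R + ‖y‖) (x + y) (hxy hx) (ε / 2) (half_pos hε)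
  obtain ⟨s₂, δ₂, hδ₂, h₂⟩ := hf R x hx (ε / 2) (half_pos hε)
  refine ⟨s₁ ∪ s₂, min δ₁ δ₂, lt_min hδ₁ hδ₂, fun z hz H => ?_⟩
  have e₁ := h₁ (z + y) (hxy hz) fun φ hφ => by
    rw [add_sub_add_right_eq_sub]
    exact (H φ (Finset.mem_union_left _ hφ)).trans_le (min_le_left _ _)
  have e₂ := h₂ z hz fun φ hφ =>
    (H φ (Finset.mem_union_right _ hφ)).trans_le (min_le_right _ _)
  rw [sub_sub_sub_comm]
  exact (norm_sub_le _ _).trans_lt (by linarith)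

/-- Bounded sets are precompact for the weak uniformity. -/
theorem exists_finset_weak_net (s : Finset (E →L[ℂ] ℂ)) (R : ℝ) {δ : ℝ} (hδ : 0 < δ) :
    ∃ t : Finset E, (∀ y ∈ t, ‖y‖ ≤ R) ∧
      ∀ x : E, ‖x‖ ≤ R → ∃ y ∈ t, ∀ φ ∈ s, ‖φ (x - y)‖ < δ := by
  let Φ : E →L[ℂ] (s → ℂ) := ContinuousLinearMap.pi fun φ => φ.1
  have hΦ : TotallyBounded (Φ '' Metric.closedBall 0 R) :=
    (Φ.lipschitz.isBounded_image Metric.isBounded_closedBall).isCompact_closure.totallyBounded.subset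
      subset_closure
  obtain ⟨t, htA, htfin, hcov⟩ := Metric.finite_approx_of_totallyBounded hΦ δ hδ
  obtain ⟨B, hBA, hBfin, rfl⟩ := exists_subset_image_finite_and.1 ⟨t, htA, htfin, rfl⟩
  refine ⟨hBfin.toFinset, fun y hy => mem_closedBall_zero_iff.1 (hBA (hBfin.mem_toFinset.1 hy)),
    fun x hx => ?_⟩
  obtain ⟨_, ⟨b, hb, rfl⟩, hxb⟩ :=
    mem_iUnion₂.1 (hcov ⟨x, mem_closedBall_zero_iff.2 hx, rfl⟩)
  refine ⟨b, hBfin.mem_toFinset.2 hb, fun φ hφ => ?_⟩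
  rw [Metric.mem_ball, dist_eq_norm, ← map_sub] at hxb
  exact (norm_le_pi_norm (Φ (x - b)) ⟨φ, hφ⟩).trans_lt hxb

/-- A polynomial that is weakly continuous on bounded sets is weakly uniformly continuous on bounded
sets. By precompactness, two weakly close points `x`, `y` of a ball lie in `b + W` for one of
finitely many points `b`, where `W` is a weak neighbourhood of `0` on which `f` is almost constant.
Then `f x - f y` differs little from the increment of the difference `f (· + b) - f`, which has
lower degree, between `x - b` and `y - b`. -/
theorem WeaklyContinuousOnBounded.weaklyUniformlyContinuousOnBounded {n : ℕ} {f : E → ℂ}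
    (hf : WeaklyContinuousOnBounded f) (hn : HasDegreeLE n f) :
    WeaklyUniformlyContinuousOnBounded f := by
  classical
  induction n generalizing f with
  | zero =>
    intro R ε hε
    exact ⟨∅, 1, one_pos, fun x y _ _ _ => by simpa [hn x y] using hε⟩
  | succ n ih =>
    intro R ε hε
    rcases lt_or_ge R 0 with hR | hR
    · exact ⟨∅, 1, one_pos, fun x y hx => absurd ((norm_nonneg x).trans hx) hR.not_ge⟩
    -- The radius is `2 * R` because `f` is evaluated at differences of points of the ball.
    obtain ⟨s, δ, hδ, h⟩ := hf (2 * R) 0 (by simpa using hR) (ε / 3) (by positivity)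
    obtain ⟨t, htR, ht⟩ := exists_finset_weak_net s R (half_pos hδ)
    choose S D hD H using fun b => ih (hf.difference b) (hn b) (2 * R) (ε / 3) (by positivity)
    obtain ⟨d, hd, hdt⟩ : ∃ d > 0, ∀ b ∈ t, d ≤ D b := by
      rcases t.eq_empty_or_nonempty with rfl | hne
      · exact ⟨1, one_pos, by simp⟩
      · exact ⟨t.inf' hne D, (Finset.lt_inf'_iff hne).2 fun b _ => hD b,
          fun b hb => Finset.inf'_le D hb⟩
    refine ⟨s ∪ t.biUnion S, min (δ / 2) d, by positivity, fun x y hx hy hxy => ?_⟩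
    obtain ⟨b, hb, hyb⟩ := ht y hy
    have hbR := htR b hb
    have hx2 : ‖x - b‖ ≤ 2 * R := (norm_sub_le _ _).trans (by linarith)
    have hy2 : ‖y - b‖ ≤ 2 * R := (norm_sub_le _ _).trans (by linarith)
    have e₁ := h (y - b) hy2 fun φ hφ => by
      rw [sub_zero]
      linarith [hyb φ hφ]
    have e₂ := h (x - b) hx2 fun φ hφ => by
      rw [sub_zero, ← sub_add_sub_cancel x y b, map_add]
      have h1 := (hxy φ (Finset.mem_union_left _ hφ)).trans_le (min_le_left _ _)
      linarith [hyb φ hφ, norm_add_le (φ (x - y)) (φ (y - b))]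
    have e₃ := H b (x - b) (y - b) hx2 hy2 fun φ hφ => by
      rw [sub_sub_sub_cancel_right]
      exact (hxy φ (Finset.mem_union_right _ (Finset.mem_biUnion.2 ⟨b, hb, hφ⟩))).trans_le
        ((min_le_right _ _).trans (hdt b hb))
    simp only [sub_add_cancel] at e₃
    have e : f x - f y = ((f x - f (x - b)) - (f y - f (y - b))) +
        ((f (x - b) - f 0) - (f (y - b) - f 0)) := by ring
    rw [e]
    refine (norm_add_le _ _).trans_lt ?_
    linarith [norm_sub_le (f (x - b) - f 0) (f (y - b) - f 0)]

/-- A neighbourhood of a point for the weak topology contains one defined by finitely many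
functionals. -/
theorem mem_nhds_weakSpace_iff {x : E} {V : Set (WeakSpace ℂ E)} :
    V ∈ 𝓝 (toWeakSpace ℂ E x) ↔ ∃ s : Finset (E →L[ℂ] ℂ), ∃ δ > 0, ∀ y : E,
      (∀ φ ∈ s, ‖φ (y - x)‖ < δ) → toWeakSpace ℂ E y ∈ V := by
  refine ((LinearMap.weakBilin_withSeminorms (topDualPairing ℂ E).flip).mem_nhds_iff _ V).trans ?_
  refine exists_congr fun s => exists_congr fun δ => and_congr_right fun hδ => ?_
  have h (y : E) : y ∈ (s.sup (topDualPairing ℂ E).flip.toSeminormFamily).ball x δ ↔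
        ∀ φ ∈ s, ‖φ (y - x)‖ < δ :=
    (Set.ext_iff.1 (Seminorm.ball_finset_sup_eq_iInter _ s x hδ) y).trans mem_iInter₂
  exact ⟨fun H y hy => H ((h y).2 hy), fun H y hy => H y ((h y).1 hy)⟩

theorem mem_weakHomPoly_iff {n : ℕ} {P : HomPoly n E ℂ} :
    P ∈ WeakHomPoly n E ↔ WeaklyContinuousOnBounded P := by
  constructor
  · intro h R x hx ε hε
    have hc := h _ (Metric.isBounded_closedBall (x := 0) (r := R)) _
      (mem_image_of_mem _ (mem_closedBall_zero_iff.2 hx))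
    obtain ⟨s, δ, hδ, H⟩ := mem_nhds_weakSpace_iff.1
      (mem_nhdsWithin_iff_eventually.1 (Metric.continuousWithinAt_iff'.1 hc ε hε))
    refine ⟨s, δ, hδ, fun y hy hyx => ?_⟩
    have := H y hyx (mem_image_of_mem _ (mem_closedBall_zero_iff.2 hy))
    rwa [mem_ofPred_eq, dist_eq_norm] at this
  · rintro h B hB _ ⟨x, hx, rfl⟩
    obtain ⟨R, hR⟩ := hB.exists_norm_le
    refine Metric.continuousWithinAt_iff'.2 fun ε hε => ?_
    obtain ⟨s, δ, hδ, H⟩ := h R x (hR x hx) ε hε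
    rw [eventually_nhdsWithin_iff]
    refine mem_nhds_weakSpace_iff.2 ⟨s, δ, hδ, ?_⟩
    rintro y hyx ⟨y', hy', e⟩
    obtain rfl := (toWeakSpace ℂ E).injective e
    rw [dist_eq_norm]
    exact H _ (hR _ hy') hyx

end WeakContinuity

/-! ### The Taylor decomposition of a space of holomorphic functions -/

section Decomposition

variable {E : Type u} [NormedAddCommGroup E] {F : Type v} [NormedAddCommGroup F] [NormedSpace ℂ F]
  {U : Set E}

theorem tendsto_submodule_uniformOnFun_iff {X : Submodule ℂ (U →ᵤ[uBoundedSets U] F)} {ι : Type*}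
    {l : Filter ι} {g : ι → X} {f : X} :
    Filter.Tendsto g l (𝓝 f) ↔ ∀ A ∈ uBoundedSets U, ∀ ε > 0, ∀ᶠ i in l, ∀ x ∈ A,
      ‖UniformOnFun.toFun _ (g i : U →ᵤ[uBoundedSets U] F) x -
        UniformOnFun.toFun _ (f : U →ᵤ[uBoundedSets U] F) x‖ < ε := by
  rw [tendsto_subtype_rng, UniformOnFun.tendsto_iff_tendstoUniformlyOn]
  simp only [Metric.tendstoUniformlyOn_iff, dist_eq_norm, norm_sub_rev, Function.comp_apply]

variable [NormedSpace ℂ E]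

namespace HomPoly

theorem norm_apply_le_of_norm_le_one {n : ℕ} (P : HomPoly n E F) {x : E} (hx : ‖x‖ ≤ 1) :
    ‖P x‖ ≤ ‖P‖ :=
  (toBall P).norm_coe_le_norm ⟨x, mem_closedBall_zero_iff.2 hx⟩

theorem norm_apply_le {n : ℕ} (P : HomPoly n E F) (x : E) : ‖P x‖ ≤ ‖P‖ * ‖x‖ ^ n := by
  obtain ⟨y, hy, hxy⟩ : ∃ y : E, ‖y‖ ≤ 1 ∧ x = (‖x‖ : ℂ) • y := by
    rcases eq_or_ne x 0 with rfl | hx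
    · exact ⟨0, by simp, by simp⟩
    · have hx' : (‖x‖ : ℂ) ≠ 0 := by exact_mod_cast norm_ne_zero_iff.2 hx
      refine ⟨(‖x‖ : ℂ)⁻¹ • x, ?_, (smul_inv_smul₀ hx' x).symm⟩
      rw [norm_smul, norm_inv, Complex.norm_real, norm_norm,
        inv_mul_cancel₀ (norm_ne_zero_iff.2 hx)]
  calc ‖P x‖ = ‖x‖ ^ n * ‖P y‖ := by
        rw [hxy, map_smul, norm_smul, norm_pow, Complex.norm_real, norm_norm, ← hxy]
    _ ≤ ‖x‖ ^ n * ‖P‖ := by gcongr; exact P.norm_apply_le_of_norm_le_one hy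
    _ = ‖P‖ * ‖x‖ ^ n := mul_comm _ _

theorem norm_le_of_forall {n : ℕ} (P : HomPoly n E F) {C : ℝ} (hC : 0 ≤ C)
    (h : ∀ x : E, ‖x‖ ≤ 1 → ‖P x‖ ≤ C) : ‖P‖ ≤ C :=
  (BoundedContinuousFunction.norm_le hC).2 fun x => h x (mem_closedBall_zero_iff.1 x.2)

theorem analyticOnNhd {n : ℕ} (P : HomPoly n E F) (s : Set E) : AnalyticOnNhd ℂ P s := by
  obtain ⟨A, hA⟩ := P.exists_multilinear
  have h : (P : E → F) = A ∘ ContinuousLinearMap.pi fun _ : Fin n => .id ℂ E := funext hA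
  rw [h]
  exact fun x _ => A.analyticAt.comp (ContinuousLinearMap.analyticAt _ x)

/-- The restriction of a homogeneous polynomial to `U`. -/
def restrict (U : Set E) {n : ℕ} (P : HomPoly n E F) : U →ᵤ[uBoundedSets U] F :=
  UniformOnFun.ofFun _ fun x : U => P x

theorem restrict_mem_holomorphicBounded (U : Set E) {n : ℕ} (P : HomPoly n E F) :
    P.restrict U ∈ HolomorphicBounded U F := by
  refine ⟨⟨P, P.analyticOnNhd U, fun _ => rfl⟩, fun A hA => ?_⟩
  obtain ⟨⟨M, hM⟩, -⟩ := mem_uBoundedSets_iff.1 hA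
  refine isBounded_iff_forall_norm_le.2 ⟨‖P‖ * M ^ n, ?_⟩
  rintro _ ⟨x, hx, rfl⟩
  exact (P.norm_apply_le x).trans (by gcongr; exact hM x hx)

end HomPoly

/-- A compact set of functions that are bounded on `A` is uniformly bounded on `A`. -/
theorem exists_bound_of_isCompact {X : Submodule ℂ (U →ᵤ[uBoundedSets U] F)}
    (hX : X ≤ HolomorphicBounded U F) {K : Set X} (hK : IsCompact K) {A : Set U}
    (hA : A ∈ uBoundedSets U) : ∃ C, ∀ f ∈ K, ∀ x ∈ A,
      ‖UniformOnFun.toFun _ (f : U →ᵤ[uBoundedSets U] F) x‖ ≤ C := by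
  refine hK.induction_on (p := fun K => ∃ C, ∀ f ∈ K, ∀ x ∈ A,
    ‖UniformOnFun.toFun _ (f : U →ᵤ[uBoundedSets U] F) x‖ ≤ C) ⟨0, by simp⟩ ?_ ?_ ?_
  · rintro s t hst ⟨C, hC⟩
    exact ⟨C, fun f hf => hC f (hst hf)⟩
  · rintro s t ⟨C, hC⟩ ⟨D, hD⟩
    refine ⟨max C D, ?_⟩
    rintro f (hf | hf) x hx
    · exact (hC f hf x hx).trans (le_max_left _ _)
    · exact (hD f hf x hx).trans (le_max_right _ _)
  · intro f _
    obtain ⟨C, hC⟩ := isBounded_iff_forall_norm_le.1 ((hX f.2).2 A hA)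
    refine ⟨_, mem_nhdsWithin_of_mem_nhds
      (tendsto_submodule_uniformOnFun_iff.1 Filter.tendsto_id A hA 1 one_pos),
      C + 1, fun g hg x hx => ?_⟩
    have h1 := hg x hx
    have h2 := hC _ (mem_image_of_mem _ hx)
    have h3 := norm_le_norm_add_norm_sub' (UniformOnFun.toFun _ (g : U →ᵤ[uBoundedSets U] F) x)
      (UniformOnFun.toFun _ (f : U →ᵤ[uBoundedSets U] F) x)
    rw [id] at h1
    linarith

/-- Restriction to `U` as an operator from a space of homogeneous polynomials to a space of
functions on `U`. -/
def restrictCLM {n : ℕ} (Y : Submodule ℂ (HomPoly n E F))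
    (X : Submodule ℂ (U →ᵤ[uBoundedSets U] F)) (hY : ∀ P ∈ Y, P.restrict U ∈ X) : Y →L[ℂ] X :=
  let T : Y →ₗ[ℂ] X :=
    { toFun P := ⟨P.1.restrict U, hY P P.2⟩, map_add' _ _ := rfl, map_smul' _ _ := rfl }
  { T with
    cont := by
      refine continuous_of_continuousAt_zero T ?_
      rw [ContinuousAt, map_zero, tendsto_submodule_uniformOnFun_iff]
      intro A hA ε hε
      obtain ⟨⟨M, hM⟩, -⟩ := mem_uBoundedSets_iff.1 hA
      have hC : 0 < |M| ^ n + 1 := by positivity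
      filter_upwards [Metric.ball_mem_nhds (0 : Y) (div_pos hε hC)] with P hP x hx
      rw [mem_ball_zero_iff, lt_div_iff₀ hC] at hP
      change ‖P.1 x - 0‖ < ε
      rw [sub_zero]
      calc ‖P.1 x‖ ≤ ‖P‖ * ‖(x : E)‖ ^ n := P.1.norm_apply_le x
        _ ≤ ‖P‖ * (|M| ^ n + 1) := by
          gcongr
          have : ‖(x : E)‖ ^ n ≤ |M| ^ n := by gcongr; exact (hM x hx).trans (le_abs_self M)
          linarith
        _ < ε := hP }

variable [CompleteSpace F] (hU : IsOpen U) (hbal : Balanced ℂ U) (h0 : (0 : E) ∈ U)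

/-- The operator that maps a function to its `n`-th Taylor polynomial at the origin. -/
def taylorCLM {n : ℕ} (Y : Submodule ℂ (HomPoly n E F))
    (X : Submodule ℂ (U →ᵤ[uBoundedSets U] F)) (hX : X ≤ HolomorphicBounded U F)
    (hY : ∀ f (hf : f ∈ X), taylorPoly hU hbal h0 n (UniformOnFun.toFun _ f) (hX hf).1 ∈ Y) :
    X →L[ℂ] Y :=
  let T : X →ₗ[ℂ] Y :=
    { toFun f := ⟨taylorPoly hU hbal h0 n (UniformOnFun.toFun _ f.1) (hX f.2).1, hY f f.2⟩
      map_add' f g := Subtype.ext <| HomPoly.eq_of_eqOn (hU.mem_nhds h0) fun x hx => by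
        simp only [Submodule.coe_add, HomPoly.add_apply, taylorPoly_apply hU hbal h0 n _ hx]
        exact cauchyCoeff_add hU hbal (hX f.2).1 (hX g.2).1 n hx
      map_smul' c f := Subtype.ext <| HomPoly.eq_of_eqOn (hU.mem_nhds h0) fun x hx => by
        simp only [Submodule.coe_smul, HomPoly.smul_apply, taylorPoly_apply hU hbal h0 n _ hx,
          RingHom.id_apply]
        exact cauchyCoeff_smul c _ hbal n hx }
  { T with
    cont := by
      refine continuous_of_continuousAt_zero T ?_
      rw [ContinuousAt, map_zero, Metric.tendsto_nhds]
      intro ε hε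
      obtain ⟨ρ, hρ, hρU, hA⟩ := exists_closedBall_mem_uBoundedSets hU h0
      have h := tendsto_submodule_uniformOnFun_iff.1 (Filter.tendsto_id (x := 𝓝 (0 : X))) _ hA
        (ε / 2 * ρ ^ n) (by positivity)
      filter_upwards [h] with f hf
      rw [dist_zero_right]
      refine lt_of_le_of_lt (b := ε / 2) ?_ (by linarith)
      refine HomPoly.norm_le_of_forall _ (by positivity) fun x hx => ?_
      -- Cauchy's estimate holds at `ρx`, where `f` is defined; homogeneity transfers it to `x`.
      have hρn : ‖(ρ : ℂ)‖ = ρ := by rw [Complex.norm_real, Real.norm_of_nonneg hρ.le]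
      have hz (z : ℂ) (hz : ‖z‖ ≤ 1) : ‖z • (ρ : ℂ) • x‖ ≤ ρ := by
        rw [norm_smul, norm_smul, hρn]
        calc ‖z‖ * (ρ * ‖x‖) ≤ 1 * (ρ * 1) := by gcongr
          _ = ρ := by ring
      have hmem (z : ℂ) (hz1 : ‖z‖ ≤ 1) : z • (ρ : ℂ) • x ∈ U :=
        hρU (mem_closedBall_zero_iff.2 (hz z hz1))
      have hx' : (ρ : ℂ) • x ∈ U := by simpa using hmem 1 (by simp)
      have key : ‖cauchyCoeff n (UniformOnFun.toFun _ f.1) ((ρ : ℂ) • x)‖ ≤ ε / 2 * ρ ^ n := by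
        refine norm_cauchyCoeff_le n fun z hz1 => ?_
        have e : ‖UniformOnFun.toFun _ f.1 ⟨_, hmem z hz1.le⟩ - 0‖ ≤ ε / 2 * ρ ^ n :=
          (hf ⟨_, hmem z hz1.le⟩ (hz z hz1.le)).le
        rwa [sub_zero, ← zeroExtend_apply (UniformOnFun.toFun _ f.1)] at e
      rw [← taylorPoly_apply hU hbal h0 n (hX f.2).1 hx', HomPoly.map_smul, norm_smul, norm_pow,
        hρn, mul_comm] at key
      exact le_of_mul_le_mul_right key (by positivity) }

/-- The partial sums of the Taylor series converge to the function, uniformly on a `U`-bounded set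
`A` and for all functions of a compact set: for some `r > 1` the functions are uniformly bounded on
the dilation of `A` by `r`, so that by Cauchy's estimate the Taylor series is dominated on `A` by a
geometric series with ratio `r⁻¹`. -/
theorem eventually_norm_sum_taylorPoly_sub_lt {X : Submodule ℂ (U →ᵤ[uBoundedSets U] F)}
    (hX : X ≤ HolomorphicBounded U F) {K : Set X} (hK : IsCompact K) {A : Set U}
    (hA : A ∈ uBoundedSets U) {ε : ℝ} (hε : 0 < ε) : ∀ᶠ N in Filter.atTop, ∀ f ∈ K, ∀ x ∈ A,
      ‖(∑ n ∈ Finset.range N,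
        taylorPoly hU hbal h0 n (UniformOnFun.toFun _ (f : U →ᵤ[uBoundedSets U] F)) (hX f.2).1 x) -
          UniformOnFun.toFun _ (f : U →ᵤ[uBoundedSets U] F) x‖ < ε := by
  obtain ⟨r, hr, hrU, hrA⟩ := exists_one_lt_dilation_mem_uBoundedSets hU hbal h0 hA
  obtain ⟨C, hC⟩ := exists_bound_of_isCompact hX hK hrA
  have hr0 : 0 < r := by linarith
  have hrn : ‖(r : ℂ)‖ = r := by rw [Complex.norm_real, Real.norm_of_nonneg hr0.le]
  have hr1 : r⁻¹ < 1 := inv_lt_one_of_one_lt₀ hr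
  have ht : Filter.Tendsto (fun N : ℕ => C * r⁻¹ ^ N / (1 - r⁻¹)) Filter.atTop (𝓝 0) := by
    simpa using ((tendsto_pow_atTop_nhds_zero_of_lt_one (by positivity) hr1).const_mul C).div_const
      (1 - r⁻¹)
  filter_upwards [ht.eventually_lt_const hε] with N hN f hf x hx
  refine lt_of_le_of_lt ?_ hN
  refine norm_sub_le_of_geometric_bound_of_hasSum hr1 (fun n => ?_)
    (hasSum_taylorPoly hU hbal h0 (hX f.2).1 x) N
  have hrx : (r : ℂ) • (x : E) ∈ U := hrU x hx r hrn.le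
  have key : ‖cauchyCoeff n (UniformOnFun.toFun _ f.1) ((r : ℂ) • (x : E))‖ ≤ C := by
    refine norm_cauchyCoeff_le n fun z hz1 => ?_
    have hzr : ‖z * r‖ ≤ r := by rw [norm_mul, hz1, hrn, one_mul]
    have e := hC f hf ⟨_, hrU x hx _ hzr⟩ ⟨x, hx, _, hzr, rfl⟩
    rw [← zeroExtend_apply (UniformOnFun.toFun _ f.1)] at e
    rwa [smul_smul]
  rw [← taylorPoly_apply hU hbal h0 n (hX f.2).1 hrx, HomPoly.map_smul, norm_smul, norm_pow,
    hrn] at key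
  rw [inv_pow, ← div_eq_mul_inv, le_div_iff₀ (by positivity), mul_comm]
  exact key

end Decomposition

/-- A space `X` of holomorphic functions has the approximation property if and only if the spaces
`Y n` of its Taylor polynomials have it. -/
theorem OperatorIdeal.hasAP_iff_forall_taylor (I : OperatorIdeal.{max u v})
    {E : Type u} [NormedAddCommGroup E] [NormedSpace ℂ E]
    {F : Type v} [NormedAddCommGroup F] [NormedSpace ℂ F] [CompleteSpace F]
    {U : Set E} (hU : IsOpen U) (hbal : Balanced ℂ U) (h0 : (0 : E) ∈ U)
    (X : Submodule ℂ (U →ᵤ[uBoundedSets U] F)) [ContinuousSMul ℂ X]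
    (Y : ∀ n, Submodule ℂ (HomPoly n E F)) (hX : X ≤ HolomorphicBounded U F)
    (hYX : ∀ n, ∀ P ∈ Y n, P.restrict U ∈ X)
    (hXY : ∀ n f (hf : f ∈ X),
      taylorPoly hU hbal h0 n (UniformOnFun.toFun _ f) (hX hf).1 ∈ Y n) :
    I.HasAP X ↔ ∀ n, I.HasAP (Y n) := by
  constructor
  · intro h n
    refine h.of_retract (restrictCLM (Y n) X (hYX n)) (taylorCLM hU hbal h0 (Y n) X hX (hXY n))
      fun P => Subtype.ext ?_
    exact HomPoly.eq_taylorPoly hU hbal h0 n (hX (hYX n P P.2)).1 fun _ => rfl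
  · intro h
    refine HasAP.of_tendsto_sum h (fun n => restrictCLM (Y n) X (hYX n))
      (fun n => taylorCLM hU hbal h0 (Y n) X hX (hXY n)) fun K hK W hW => ?_
    rw [← Filter.eventually_prod_principal_iff
      (p := fun q : ℕ × X => (∑ n ∈ Finset.range q.1, restrictCLM (Y n) X (hYX n)
        (taylorCLM hU hbal h0 (Y n) X hX (hXY n) q.2)) - q.2 ∈ W)]
    refine (tendsto_submodule_uniformOnFun_iff.2 fun A hA ε hε => ?_).eventually hW
    rw [Filter.eventually_prod_principal_iff]
    filter_upwards [eventually_norm_sum_taylorPoly_sub_lt hU hbal h0 hX hK hA hε] with N hN f hf x hx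
    let ev : X →+ F :=
      { toFun g := UniformOnFun.toFun _ g.1 x, map_zero' := rfl, map_add' _ _ := rfl }
    have hs : ev (∑ n ∈ Finset.range N, restrictCLM (Y n) X (hYX n)
        (taylorCLM hU hbal h0 (Y n) X hX (hXY n) f)) = ∑ n ∈ Finset.range N,
          taylorPoly hU hbal h0 n (UniformOnFun.toFun _ f.1) (hX f.2).1 x := map_sum ev _ _
    change ‖ev (_ - f) - 0‖ < ε
    rw [sub_zero, map_sub, hs]
    exact hN f hf x hx

/-! ### Taylor polynomials of weakly uniformly continuous functions -/

section Weak

variable {E : Type u} [NormedAddCommGroup E] [NormedSpace ℂ E] {U : Set E}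

theorem holomorphicWeakUniform_le : HolomorphicWeakUniform U ≤ HolomorphicBounded U ℂ :=
  fun _ hf => ⟨hf.1, fun A hA => (hf.2 A hA).isBounded_image hA.1⟩

theorem HomPoly.restrict_mem_holomorphicWeakUniform {n : ℕ} {P : HomPoly n E ℂ}
    (hP : P ∈ WeakHomPoly n E) : P.restrict U ∈ HolomorphicWeakUniform U := by
  refine ⟨⟨P, P.analyticOnNhd U, fun _ => rfl⟩, fun A hA ε hε => ?_⟩
  obtain ⟨⟨M, hM⟩, -⟩ := mem_uBoundedSets_iff.1 hA
  obtain ⟨s, δ, hδ, h⟩ :=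
    (mem_weakHomPoly_iff.1 hP).weaklyUniformlyContinuousOnBounded P.hasDegreeLE M ε hε
  exact ⟨s, δ, hδ, fun x hx y hy => h x y (hM x hx) (hM y hy)⟩

/-- By Cauchy's estimate for differences the Taylor polynomials inherit weak uniform continuity on a
ball around the origin; by homogeneity they then have it on every ball. -/
theorem taylorPoly_mem_weakHomPoly (hU : IsOpen U) (hbal : Balanced ℂ U) (h0 : (0 : E) ∈ U) (n : ℕ)
    {f : U → ℂ} (hf : IsHolomorphic U f)
    (hw : ∀ A ∈ uBoundedSets U, WeaklyUniformlyContinuousOn f A) :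
    taylorPoly hU hbal h0 n f hf ∈ WeakHomPoly n E := by
  refine mem_weakHomPoly_iff.2 (WeaklyUniformlyContinuousOnBounded.weaklyContinuousOnBounded ?_)
  intro R ε hε
  obtain ⟨ρ, hρ, hρU, hA⟩ := exists_closedBall_mem_uBoundedSets hU h0
  -- Multiplication by `c` maps the ball of radius `R` into the ball of radius `ρ`.
  obtain ⟨c, hc, hcR⟩ : ∃ c : ℝ, 0 < c ∧ c * R ≤ ρ := by
    refine ⟨ρ / max R 1, by positivity, ?_⟩
    rw [div_mul_eq_mul_div, div_le_iff₀ (by positivity)]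
    exact mul_le_mul_of_nonneg_left (le_max_left _ _) hρ.le
  have hcn : ‖(c : ℂ)‖ = c := by rw [Complex.norm_real, Real.norm_of_nonneg hc.le]
  obtain ⟨s, δ, hδ, h⟩ := hw _ hA (ε / 2 * c ^ n) (by positivity)
  refine ⟨s, δ / c, by positivity, fun x y hx hy hxy => ?_⟩
  have hz {w : E} (hw : ‖w‖ ≤ R) {z : ℂ} (hz : ‖z‖ ≤ 1) : ‖z • (c : ℂ) • w‖ ≤ ρ := by
    rw [norm_smul, norm_smul, hcn]
    calc ‖z‖ * (c * ‖w‖) ≤ 1 * (c * R) := by gcongr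
      _ ≤ ρ := by linarith
  have hmem {w : E} (hw : ‖w‖ ≤ R) {z : ℂ} (hz1 : ‖z‖ ≤ 1) : z • (c : ℂ) • w ∈ U :=
    hρU (mem_closedBall_zero_iff.2 (hz hw hz1))
  have hmem' {w : E} (hw : ‖w‖ ≤ R) : (c : ℂ) • w ∈ U := by simpa using hmem hw (z := 1) (by simp)
  have key : ‖cauchyCoeff n f ((c : ℂ) • x) - cauchyCoeff n f ((c : ℂ) • y)‖ ≤ ε / 2 * c ^ n := by
    refine norm_cauchyCoeff_sub_le hU hbal hf n (hmem' hx) (hmem' hy) fun z hz1 => ?_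
    have e := (h ⟨_, hmem hx hz1.le⟩ (hz hx hz1.le) ⟨_, hmem hy hz1.le⟩ (hz hy hz1.le)
      fun φ hφ => by
        have := hxy φ hφ
        rw [lt_div_iff₀ hc] at this
        rwa [← smul_sub, ← smul_sub, map_smul, map_smul, norm_smul, norm_smul, hz1, hcn, one_mul,
          mul_comm]).le
    rwa [← zeroExtend_apply f, ← zeroExtend_apply f] at e
  rw [← taylorPoly_apply hU hbal h0 n hf (hmem' hx), ← taylorPoly_apply hU hbal h0 n hf (hmem' hy),
    HomPoly.map_smul, HomPoly.map_smul, ← smul_sub, norm_smul, norm_pow, hcn, mul_comm] at key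
  linarith [le_of_mul_le_mul_right key (pow_pos hc n)]

end Weak

/-! ### Polynomials of degree zero -/

section DegreeZero

variable {E : Type u} [NormedAddCommGroup E] [NormedSpace ℂ E]
  {F : Type v} [NormedAddCommGroup F] [NormedSpace ℂ F]

theorem HomPoly.apply_eq_apply_zero (P : HomPoly 0 E F) (x : E) : P x = P 0 := by
  simpa using (P.map_smul 0 x).symm

/-- The operator `P ↦ φ · P` from constants to linear maps. -/
def HomPoly.mulFunctional (φ : E →L[ℂ] ℂ) : HomPoly 0 E F →L[ℂ] HomPoly 1 E F :=
  LinearMap.mkContinuous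
    { toFun P := ⟨fun x => φ x • P 0, ContinuousMultilinearMap.ofSubsingleton ℂ E F (0 : Fin 1)
        (φ.smulRight (P 0)), fun x => by simp⟩
      map_add' P Q := DFunLike.ext _ _ fun x => smul_add _ _ _
      map_smul' c P := DFunLike.ext _ _ fun x => smul_comm _ _ _ }
    ‖φ‖ fun P => HomPoly.norm_le_of_forall _ (by positivity) fun x hx => by
      change ‖φ x • P 0‖ ≤ ‖φ‖ * ‖P‖
      rw [norm_smul]
      gcongr
      · exact φ.le_of_opNorm_le_of_le le_rfl hx |>.trans_eq (mul_one _)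
      · exact P.norm_apply_le_of_norm_le_one (by simp)

/-- The operator that maps a linear map to the constant function with its value at `a`. -/
def HomPoly.constEval (a : E) : HomPoly 1 E F →L[ℂ] HomPoly 0 E F :=
  LinearMap.mkContinuous
    { toFun P := ⟨fun _ => P a, ContinuousMultilinearMap.constOfIsEmpty ℂ _ (P a), fun x => by simp⟩
      map_add' P Q := rfl
      map_smul' c P := rfl }
    ‖a‖ fun P => HomPoly.norm_le_of_forall _ (by positivity) fun x hx => by
      change ‖P a‖ ≤ ‖a‖ * ‖P‖
      simpa [mul_comm] using P.norm_apply_le a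

/-- If `E ≠ 0`, then the constants are a retract of the linear maps. -/
theorem OperatorIdeal.HasAP.homPoly_zero {I : OperatorIdeal.{u}} {F : Type u}
    [NormedAddCommGroup F] [NormedSpace ℂ F] [Nontrivial E] (h : I.HasAP (HomPoly 1 E F)) :
    I.HasAP (HomPoly 0 E F) := by
  obtain ⟨a, ha⟩ := exists_ne (0 : E)
  obtain ⟨φ, hφ⟩ := SeparatingDual.exists_eq_one (R := ℂ) ha
  refine h.of_retract (HomPoly.mulFunctional φ) (HomPoly.constEval a) fun P =>
    DFunLike.ext _ _ fun x => ?_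
  change φ a • P 0 = P x
  rw [hφ, one_smul, P.apply_eq_apply_zero x]

instance : FiniteDimensional ℂ (HomPoly 0 E ℂ) :=
  Module.Finite.of_injective
    ({ toFun P := P 0, map_add' _ _ := rfl, map_smul' _ _ := rfl } : HomPoly 0 E ℂ →ₗ[ℂ] ℂ)
    fun P Q h => DFunLike.ext _ _ fun x => by
      rw [P.apply_eq_apply_zero x, Q.apply_eq_apply_zero x]
      exact h

end DegreeZero

theorem OperatorIdeal.hasAP_top_iff {I : OperatorIdeal.{u}} {X : Type u} [NormedAddCommGroup X]
    [NormedSpace ℂ X] : I.HasAP (⊤ : Submodule ℂ X) ↔ I.HasAP X :=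
  ⟨fun h => h.of_retract ((ContinuousLinearMap.id ℂ X).codRestrict ⊤ fun _ => trivial)
      (Submodule.subtypeL ⊤) fun _ => rfl,
    fun h => h.of_retract (Submodule.subtypeL ⊤)
      ((ContinuousLinearMap.id ℂ X).codRestrict ⊤ fun _ => trivial) fun _ => rfl⟩

end

theorem mainTheorem8 (I : OperatorIdeal.{u})
    (E : Type u) [NormedAddCommGroup E] [NormedSpace ℂ E] [CompleteSpace E]
    (F : Type u) [NormedAddCommGroup F] [NormedSpace ℂ F] [CompleteSpace F]
    (U : Set E) (hU : IsOpen U) (hbal : Balanced ℂ U) (hne : U.Nonempty) :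
    ((I.HasAP (HolomorphicBounded U F) ↔ ∀ n : ℕ, I.HasAP (HomPoly n E F)) ∧
      (Nontrivial E →
        (I.HasAP (HolomorphicBounded U F) ↔ ∀ n : ℕ, 1 ≤ n → I.HasAP (HomPoly n E F)))) ∧
    (I.HasAP (HolomorphicWeakUniform U) ↔ ∀ n : ℕ, 1 ≤ n → I.HasAP (WeakHomPoly n E)) := by
  have h0 : (0 : E) ∈ U := hbal.zero_mem hne
  have ha : I.HasAP (HolomorphicBounded U F) ↔ ∀ n : ℕ, I.HasAP (HomPoly n E F) :=
    (I.hasAP_iff_forall_taylor hU hbal h0 (HolomorphicBounded U F) (fun _ => ⊤) le_rfl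
      (fun _ P _ => P.restrict_mem_holomorphicBounded U) fun _ _ _ => trivial).trans
      (forall_congr' fun _ => OperatorIdeal.hasAP_top_iff)
  have hb : I.HasAP (HolomorphicWeakUniform U) ↔ ∀ n : ℕ, I.HasAP (WeakHomPoly n E) :=
    OperatorIdeal.hasAP_iff_forall_taylor.{u, 0} I hU hbal h0 (HolomorphicWeakUniform U)
      (fun n => WeakHomPoly n E) holomorphicWeakUniform_le
      (fun _ _ hP => HomPoly.restrict_mem_holomorphicWeakUniform hP)
      fun n _ hf => taylorPoly_mem_weakHomPoly hU hbal h0 n hf.1 hf.2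
  refine ⟨⟨ha, fun _ => ha.trans ⟨fun h n _ => h n, fun h n => ?_⟩⟩,
    hb.trans ⟨fun h n _ => h n, fun h n => ?_⟩⟩
  · rcases n.eq_zero_or_pos with rfl | hn
    · exact (h 1 le_rfl).homPoly_zero
    · exact h n hn
  · rcases n.eq_zero_or_pos with rfl | hn
    · exact I.hasAP_of_finiteDimensional (WeakHomPoly 0 E)
    · exact h n hn
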